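/- \textbf{Model.} Let $\mathcal E$ be a finite set of links, $R\in\mathbb R_{\ge 0}^{\mathcal E\times\mathcal E}$ a routing matrix all of whose row sums are at most $1$, and $\delta_{ji}\ge 0$ the travel time from link $j$ to link $i$. Put $\mathcal E_i=\{j: R_{ji}>0,\ \delta_{ji}=0\}$ and $\bar\delta_j=\max\{\delta_{ji}: R_{ji}>0\}$ (with $\max\emptyset=0$). Let $\lambda_i,c_i:\mathbb R_{\ge 0}\to\mathbb R_{\ge 0}$, $i\in\mathcal E$, be the external inflow and capacity functions, and let $\eta\in\mathbb R_{>0}^{\mathcal E}$. A trajectory consists of queue lengths $x(t)\in\mathbb R_{\ge 0}^{\mathcal E}$, $t\ge 0$, and outflows $z_j$ on $[-\bar\delta_j,\infty)$, $j\in\mathcal E$, where $z_j$ is nonnegative and piecewise constant on $[-\bar\delta_j,0)$ (past departures) and locally integrable on $[0,\infty)$, such that for all $t\ge 0$, with $\tilde\lambda_i(t)=\lambda_i(t)+\sum_{j\notin\mathcal E_i}R_{ji}z_j(t-\delta_{ji})$ (terms with $R_{ji}=0$ being zero), the vector $z(t)$ is an optimal solution of the linear program $$\max_{w\in\mathbb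 R^{\mathcal E}}\ \eta^Tw\quad\text{s.t.}\quad w_i\le c_i(t)\ (i\in\mathcal E),\qquad w_i\le\tilde\lambda_i(t)+\sum_{j\in\mathcal E_i}R_{ji}w_j\ \text{ whenever } x_i(t)=0,$$ and $\dot x_i=\tilde\lambda_i+\sum_{j\in\mathcal E_i}R_{ji}z_j-z_i$ holds in integrated form, i.e. $x_i(t)=x_i(0)+\int_0^t\big(\tilde\lambda_i(s)+\sum_{j\in\mathcal E_i}R_{ji}z_j(s)-z_i(s)\big)ds$ for all $t\ge0$ and $i\in\mathcal E$. Let $\beta(t)=\{z_j(s): s\in[t-\bar\delta_j,t)\}_{j\in\mathcal E}$ denote the departure history. For two trajectories $(x,\beta)$ and $(\tilde x,\tilde\beta)$ with outflows $z$ and $\tilde z$, put $$\|x(t)-\tilde x(t)\|_1=\sum_{i}|x_i(t)-\tilde x_i(t)|,\qquad \|\beta(t)-\tilde\beta(t)\|_1=\sum_{i}\sum_{j}R_{ji}\int_{t-\delta_{ji}}^t|z_j(s)-\tilde z_j(s)|\,ds .$$ Piecewise constant on an interval $[a,b)$ means constant on each piece of some finite partition of it into intervals closed on the left and open on the right. \textbf{Proposition.}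 Suppose that all $\lambda_i$ and $c_i$ are piecewise constant on $[0,b)$ for every $b>0$, and let $(x,\beta)$ and $(\tilde x,\tilde\beta)$ be two trajectories with the same $\lambda$, $c$ and $\eta$. Then for all $t\ge 0$ $$\|x(t)-\tilde x(t)\|_1+\|\beta(t)-\tilde\beta(t)\|_1\le\|x(0)-\tilde x(0)\|_1+\|\beta(0)-\tilde\beta(0)\|_1 .$$ Moreover, suppose that $\lambda$ and $c$ are periodic with a common period $T>0$ and that the stability condition holds: there is $\epsilon>0$ with $[I-R^T]\bar c>\bar\lambda+\epsilon\mathbf 1$ componentwise, where $\bar\lambda_i=\frac1T\int_0^T\lambda_i(t)\,dt$ and $\bar c_i=\frac1T\int_0^Tc_i(t)\,dt$. Then $$\lim_{t\to\infty}\|x(t)-\tilde x(t)\|_1=0,\qquad \lim_{t\to\infty}\|\beta(t)-\tilde\beta(t)\|_1=0 .$$ -/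

import Mathlib

open scoped NNReal Matrix

/-- A traffic network on a finite set `E` of links: `R j i` is the fraction of the flow departing
link `j` that is routed to link `i`, and `δ j i` is the travel time from link `j` to link `i`. -/
structure TrafficNetwork (E : Type*) [Fintype E] where
  R : Matrix E E ℝ
  δ : E → E → ℝ≥0
  R_nonneg : ∀ j i, 0 ≤ R j i
  R_rowSum_le_one : ∀ j, ∑ i, R j i ≤ 1

/-- `f` is piecewise constant on `[a, b)`: there are finitely many points
`a = p 0 ≤ p 1 ≤ ⋯ ≤ p n = b` such that `f` is constant on every `[p k, p (k + 1))`. -/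
def PiecewiseConstantOn (f : ℝ → ℝ) (a b : ℝ) : Prop :=
  ∃ (n : ℕ) (p : ℕ → ℝ), Monotone p ∧ p 0 = a ∧ p n = b ∧
    ∀ k < n, ∀ t ∈ Set.Ico (p k) (p (k + 1)), f t = f (p k)

namespace TrafficNetwork

noncomputable section

variable {E : Type*} [Fintype E] (N : TrafficNetwork E)

open Classical in
/-- The set `E_i` of links upstream of `i` with zero travel time to `i`. -/
def zeroDelay (i : E) : Finset E :=
  Finset.univ.filter fun j => 0 < N.R j i ∧ N.δ j i = 0

open Classical in
/-- The longest travel time `δ̄_j` from link `j` to a downstream link (zero if there is none). -/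
def maxDelay (j : E) : ℝ≥0 :=
  (Finset.univ.filter fun i => 0 < N.R j i).sup (N.δ j)

open Classical in
/-- The net inflow `λ̃_i(t)`: external arrivals at `i`, plus arrivals of vehicles that
were travelling towards `i` until time `t`. -/
def netInflow (lam z : ℝ → E → ℝ) (t : ℝ) (i : E) : ℝ :=
  lam t i + ∑ j ∈ Finset.univ \ N.zeroDelay i, N.R j i * z (t - N.δ j i) j

/-- The feasible set of the linear program for the outflows, where `x` is the vector of queue
lengths, `inflow` the net inflow and `cap` the capacity. -/
def feasibleOutflows (x inflow cap : E → ℝ) : Set (E → ℝ) :=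
  {w | (∀ i, w i ≤ cap i) ∧
    ∀ i, x i = 0 → w i ≤ inflow i + ∑ j ∈ N.zeroDelay i, N.R j i * w j}

/-- `(x, z)` is a trajectory of the traffic model with objective weights `η`, external inflows
`lam` and capacities `c`. For `t ≥ 0`, `x t` are the queue lengths and `z t` the outflows; for
`t < 0`, `z t` are the past departures. The differential equation for the queue lengths is
understood in the Caratheodory sense, i.e. as an integral equation. -/
structure IsTrajectory (η : E → ℝ) (lam c x z : ℝ → E → ℝ) : Prop where
  history_nonneg : ∀ j, ∀ s ∈ Set.Ico (-(N.maxDelay j : ℝ)) 0, 0 ≤ z s j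
  history_piecewiseConstant : ∀ j, PiecewiseConstantOn (fun s => z s j) (-(N.maxDelay j : ℝ)) 0
  queue_nonneg : ∀ t, 0 ≤ t → ∀ i, 0 ≤ x t i
  outflow_intervalIntegrable : ∀ t, 0 ≤ t → ∀ i,
    IntervalIntegrable (fun s => z s i) MeasureTheory.volume 0 t
  outflow_mem : ∀ t, 0 ≤ t → z t ∈ N.feasibleOutflows (x t) (N.netInflow lam z t) (c t)
  outflow_optimal : ∀ t, 0 ≤ t →
    ∀ w ∈ N.feasibleOutflows (x t) (N.netInflow lam z t) (c t), η ⬝ᵥ w ≤ η ⬝ᵥ z t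
  queue_dynamics : ∀ t, 0 ≤ t → ∀ i,
    x t i = x 0 i + ∫ s in (0 : ℝ)..t,
      (N.netInflow lam z s i + ∑ j ∈ N.zeroDelay i, N.R j i * z s j - z s i)

/-- The `ℓ¹` norm at time `t` of the departure history of `z`, weighted by the routing fractions:
`∑ i, ∑ j, R j i * ∫_{t - δ j i}^t |z_j(s)| ds`. -/
def historyNorm (z : ℝ → E → ℝ) (t : ℝ) : ℝ :=
  ∑ i, ∑ j, N.R j i * ∫ s in (t - N.δ j i)..t, |z s j|

/-- The average over one period `[0, T]`, link by link. -/
def periodAverage (T : ℝ) (f : ℝ → E → ℝ) (i : E) : ℝ :=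
  (1 / T) * ∫ t in (0 : ℝ)..T, f t i

open Classical in
/-- The stability condition `[I - Rᵀ] c̄ > λ̄ + ε 1` for some `ε > 0`. -/
def StabilityCondition (T : ℝ) (lam c : ℝ → E → ℝ) : Prop :=
  ∃ ε : ℝ, 0 < ε ∧ ∀ i,
    ((1 - N.Rᵀ) *ᵥ periodAverage T c) i > periodAverage T lam i + ε

end

end TrafficNetwork

/-! By complementary slackness (`outflow_eq`) every outflow is at capacity or, on an empty queue,
equal to the inflow. So where two queues differ, the longer one departs at capacity, and |x_i -
x'_i| grows at a rate at most |inflow difference| - |outflow difference| (`sign_mul_le`).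
Integrating, and counting arrivals as departures corrected by the traffic in transit, gives
`abs_queue_sub_add_le`. Summed over the links, with row sums at most 1, this is the contraction.

For convergence, the same inequalities read A ≤ K + Rᵀ A, where A collects the accumulated outflow
differences. Under stability the average capacity is a strict supersolution, so A stays bounded in
time (`outflow_sub_integrableOn`). Hence the history distance vanishes and every queue difference
has a limit. Stability also empties each queue at arbitrarily late times
(`frequently_queue_eq_zero`), which forces that limit to be 0. -/

open MeasureTheory Set Filter Topology

/-! ### Absolute continuity and piecewise constant functions. -/

/-- A chain rule for the absolute value: if `f` is a primitive of `g` and `sign f * g ≤ h`, then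
`|f|` grows at most by the integral of `h`. -/
theorem abs_le_abs_add_integral_of_sign_mul_le {f g h : ℝ → ℝ} {t : ℝ} (ht : 0 ≤ t)
    (hg : IntervalIntegrable g volume 0 t) (hh : IntervalIntegrable h volume 0 t)
    (hf : ∀ s ∈ Icc 0 t, f s = f 0 + ∫ r in (0 : ℝ)..s, g r)
    (hle : ∀ s ∈ Icc 0 t, (SignType.sign (f s) : ℝ) * g s ≤ h s) :
    |f t| ≤ |f 0| + ∫ s in (0 : ℝ)..t, h s := by
  set F : ℝ → ℝ := fun s => f 0 + ∫ r in (0 : ℝ)..s, g r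
  have hFac : AbsolutelyContinuousOnInterval F 0 t :=
    ((LipschitzWith.const (f 0)).lipschitzOnWith.absolutelyContinuousOnInterval).add
      (hg.absolutelyContinuousOnInterval_intervalIntegral (c := 0) (by simp))
  have habs : AbsolutelyContinuousOnInterval (fun s => |F s|) 0 t := by
    rw [absolutelyContinuousOnInterval_iff] at hFac ⊢
    intro ε hε
    obtain ⟨d, hd, H⟩ := hFac ε hε
    refine ⟨d, hd, fun P hP hlt => (Finset.sum_le_sum fun k _ => ?_).trans_lt (H P hP hlt)⟩
    exact abs_abs_sub_abs_le_abs_sub _ _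
  have hftc := habs.integral_deriv_eq_sub
  have hFf : ∀ s ∈ Icc 0 t, F s = f s := fun s hs => (hf s hs).symm
  have hmono : ∫ s in (0 : ℝ)..t, deriv (fun s => |F s|) s ≤ ∫ s in (0 : ℝ)..t, h s := by
    refine intervalIntegral.integral_mono_ae_restrict ht habs.intervalIntegrable_deriv hh ?_
    rw [EventuallyLE, ae_restrict_iff' measurableSet_Icc]
    filter_upwards [hg.ae_hasDerivAt_integral] with s hs hst
    have hderiv : HasDerivAt F (g s) s :=
      (hs (by rwa [uIcc_of_le ht]) 0 (by simp)).const_add _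
    have hs_le := hle s hst
    rw [← hFf s hst] at hs_le
    by_cases h0 : F s = 0
    -- At a zero of `F` the derivative of |F| is 0 at a minimum, or 0 by convention where it does
    -- not exist.
    · have hmin : IsLocalMin (fun s => |F s|) s :=
        Eventually.of_forall fun r => by simp [h0]
      rw [hmin.deriv_eq_zero]
      simpa [h0] using hs_le
    · have habs_deriv : HasDerivAt (fun s => |F s|) _ s := (hasDerivAt_abs h0).comp s hderiv
      rwa [habs_deriv.deriv]
  rw [hftc, hFf t ⟨ht, le_rfl⟩, hFf 0 ⟨le_rfl, ht⟩] at hmono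
  linarith

theorem PiecewiseConstantOn.intervalIntegrable {f : ℝ → ℝ} {a b : ℝ}
    (hf : PiecewiseConstantOn f a b) : IntervalIntegrable f volume a b := by
  obtain ⟨n, p, hp, rfl, rfl, hconst⟩ := hf
  refine IntervalIntegrable.trans_iterate fun k hk => ?_
  rw [intervalIntegrable_iff_integrableOn_Ico_of_le (hp k.le_succ)]
  exact (integrableOn_const (by simp) : IntegrableOn (fun _ => f (p k)) _ _).congr_fun
    (fun s hs => (hconst k hk s hs).symm) measurableSet_Ico

/-! ### Total inflow and traffic in transit. -/

namespace TrafficNetwork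

noncomputable section

variable {E : Type*} [Fintype E] (N : TrafficNetwork E)

/-- The flow arriving at link `i` at time `t` from all upstream links, for outflows `z`. -/
def delayedInflow (z : ℝ → E → ℝ) (t : ℝ) (i : E) : ℝ :=
  ∑ j, N.R j i * z (t - N.δ j i) j

/-- The components of `z` are integrable on bounded intervals of the time axis that starts with
the departure history. -/
def DeparturesIntegrable (z : ℝ → E → ℝ) : Prop :=
  ∀ j a b, -(N.maxDelay j : ℝ) ≤ a → -(N.maxDelay j : ℝ) ≤ b →
    IntervalIntegrable (fun s => z s j) volume a b

variable {N}

/-- For links in `zeroDelay` the delayed time is `t` itself, so later arguments need not distinguish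
zero from positive delays. -/
theorem netInflow_add_zeroDelay (lam z : ℝ → E → ℝ) (t : ℝ) (i : E) :
    N.netInflow lam z t i + ∑ j ∈ N.zeroDelay i, N.R j i * z t j
      = lam t i + N.delayedInflow z t i := by
  classical
  have h0 : ∑ j ∈ N.zeroDelay i, N.R j i * z t j
      = ∑ j ∈ N.zeroDelay i, N.R j i * z (t - N.δ j i) j :=
    Finset.sum_congr rfl fun j hj => by
      have hδ : N.δ j i = 0 := (Finset.mem_filter.1 hj).2.2
      simp [hδ]
  rw [h0, netInflow, delayedInflow, add_assoc]
  congr 1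
  convert Finset.sum_sdiff (Finset.subset_univ (N.zeroDelay i)) using 2

theorem delay_le_maxDelay {j i : E} (h : 0 < N.R j i) : (N.δ j i : ℝ) ≤ N.maxDelay j := by
  classical
  exact_mod_cast Finset.le_sup (f := N.δ j) (Finset.mem_filter.2 ⟨Finset.mem_univ i, h⟩)

theorem delayedInflow_sub (z z' : ℝ → E → ℝ) (t : ℝ) (i : E) :
    N.delayedInflow (z - z') t i = N.delayedInflow z t i - N.delayedInflow z' t i := by
  simp [delayedInflow, mul_sub, Finset.sum_sub_distrib]

theorem abs_delayedInflow_le (z : ℝ → E → ℝ) (t : ℝ) (i : E) :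
    |N.delayedInflow z t i| ≤ N.delayedInflow (fun s j => |z s j|) t i := by
  refine (Finset.abs_sum_le_sum_abs _ _).trans_eq (Finset.sum_congr rfl fun j _ => ?_)
  rw [abs_mul, abs_of_nonneg (N.R_nonneg j i)]

namespace DeparturesIntegrable

variable {z z' : ℝ → E → ℝ}

theorem sub (h : N.DeparturesIntegrable z) (h' : N.DeparturesIntegrable z') :
    N.DeparturesIntegrable (z - z') :=
  fun j a b ha hb => (h j a b ha hb).sub (h' j a b ha hb)

theorem abs (h : N.DeparturesIntegrable z) : N.DeparturesIntegrable fun s j => |z s j| :=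
  fun j a b ha hb => (h j a b ha hb).abs

theorem of_nonneg (h : N.DeparturesIntegrable z) (j : E) {a b : ℝ} (ha : 0 ≤ a) (hb : 0 ≤ b) :
    IntervalIntegrable (fun s => z s j) volume a b :=
  h j a b (by linarith [(N.maxDelay j).coe_nonneg]) (by linarith [(N.maxDelay j).coe_nonneg])

theorem of_delay (h : N.DeparturesIntegrable z) {j i : E} (hR : 0 < N.R j i) {a b : ℝ}
    (ha : -(N.δ j i : ℝ) ≤ a) (hb : -(N.δ j i : ℝ) ≤ b) :
    IntervalIntegrable (fun s => z s j) volume a b :=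
  h j a b (by linarith [delay_le_maxDelay hR]) (by linarith [delay_le_maxDelay hR])

/-- `maxDelay j` dominates `δ j i` only when `R j i > 0`; otherwise the factor `R j i` removes the
term. -/
theorem term (h : N.DeparturesIntegrable z) (j i : E) {a b : ℝ} (ha : 0 ≤ a) (hb : 0 ≤ b) :
    IntervalIntegrable (fun s => N.R j i * z (s - N.δ j i) j) volume a b := by
  rcases (N.R_nonneg j i).eq_or_lt with hR | hR
  · simp [← hR]
  · have := h.of_delay hR (a := a - N.δ j i) (b := b - N.δ j i) (by linarith) (by linarith)
    simpa using (this.comp_sub_right (N.δ j i : ℝ)).const_mul (N.R j i)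

theorem delayedInflow (h : N.DeparturesIntegrable z) (i : E) {a b : ℝ} (ha : 0 ≤ a)
    (hb : 0 ≤ b) : IntervalIntegrable (fun s => N.delayedInflow z s i) volume a b := by
  have := IntervalIntegrable.sum Finset.univ fun j _ => h.term j i ha hb
  refine this.congr ?_
  intro s _
  simp [TrafficNetwork.delayedInflow]

theorem integral_delayedInflow (h : N.DeparturesIntegrable z) (i : E) {a b : ℝ} (ha : 0 ≤ a)
    (hb : 0 ≤ b) :
    ∫ s in a..b, N.delayedInflow z s i
      = ∑ j, N.R j i * ∫ s in (a - N.δ j i)..(b - N.δ j i), z s j := by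
  simp only [TrafficNetwork.delayedInflow]
  rw [intervalIntegral.integral_finsetSum fun j _ => h.term j i ha hb]
  refine Finset.sum_congr rfl fun j _ => ?_
  rw [intervalIntegral.integral_const_mul]
  congr 1
  exact intervalIntegral.integral_comp_sub_right (fun s => z s j) _

/-- Conservation of traffic: arrivals are the departures plus what was in transit at time 0, minus
what is in transit at time `t`. -/
theorem mul_integral_shift (h : N.DeparturesIntegrable z) (j i : E) {t : ℝ} (ht : 0 ≤ t) :
    N.R j i * ∫ s in (0 - N.δ j i : ℝ)..(t - N.δ j i), z s j
      = N.R j i * ((∫ s in (0 - N.δ j i : ℝ)..0, z s j)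
          + (∫ s in (0 : ℝ)..t, z s j) - ∫ s in (t - N.δ j i)..t, z s j) := by
  rcases (N.R_nonneg j i).eq_or_lt with hR | hR
  · simp [← hR]
  have hδ := (N.δ j i).coe_nonneg
  have I : ∀ a b : ℝ, -(N.δ j i : ℝ) ≤ a → -(N.δ j i : ℝ) ≤ b →
    IntervalIntegrable (fun s => z s j) volume a b := fun a b ha hb => h.of_delay hR ha hb
  have e1 := intervalIntegral.integral_add_adjacent_intervals
    (I (0 - N.δ j i) 0 (by linarith) (by linarith)) (I 0 t (by linarith) (by linarith))
  have e2 := intervalIntegral.integral_add_adjacent_intervals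
    (I (0 - N.δ j i) (t - N.δ j i) (by linarith) (by linarith))
    (I (t - N.δ j i) t (by linarith) (by linarith))
  congr 1
  linarith

end DeparturesIntegrable

/-! ### Complementary slackness and contraction of the distance. -/

namespace IsTrajectory

variable {η : E → ℝ} {lam c x z x' z' : ℝ → E → ℝ}

theorem departuresIntegrable (h : N.IsTrajectory η lam c x z) : N.DeparturesIntegrable z := by
  intro j a b ha hb
  have h0 := (h.history_piecewiseConstant j).intervalIntegrable
  have key : ∀ a, -(N.maxDelay j : ℝ) ≤ a → IntervalIntegrable (fun s => z s j) volume 0 a := by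
    intro a ha
    rcases le_total 0 a with ha0 | ha0
    · exact h.outflow_intervalIntegrable a ha0 j
    · refine h0.symm.mono_set ?_
      rw [uIcc_of_ge ha0, uIcc_of_ge (by linarith)]
      exact Icc_subset_Icc_left ha
  exact (key a ha).symm.trans (key b hb)

theorem outflow_le_capacity (h : N.IsTrajectory η lam c x z) {t : ℝ} (ht : 0 ≤ t) (i : E) :
    z t i ≤ c t i := (h.outflow_mem t ht).1 i

theorem outflow_le_inflow (h : N.IsTrajectory η lam c x z) {t : ℝ} (ht : 0 ≤ t) {i : E}
    (hx : x t i = 0) : z t i ≤ lam t i + N.delayedInflow z t i := by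
  rw [← netInflow_add_zeroDelay]
  exact (h.outflow_mem t ht).2 i hx

/-- Complementary slackness: on each link the optimal outflow attains one of its bounds. -/
theorem outflow_eq (hη : ∀ i, 0 < η i) (h : N.IsTrajectory η lam c x z) {t : ℝ} (ht : 0 ≤ t)
    (i : E) : z t i = c t i ∨ x t i = 0 ∧ z t i = lam t i + N.delayedInflow z t i := by
  classical
  by_contra! hcon
  obtain ⟨hc, hx⟩ := hcon
  have hc := lt_of_le_of_ne (h.outflow_le_capacity ht i) hc
  obtain ⟨d, hd, hdc, hdx⟩ : ∃ d, 0 < d ∧ z t i + d ≤ c t i ∧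
      (x t i = 0 → z t i + d ≤ lam t i + N.delayedInflow z t i) := by
    by_cases hx0 : x t i = 0
    · have := lt_of_le_of_ne (h.outflow_le_inflow ht hx0) (hx hx0)
      refine ⟨min (c t i) (lam t i + N.delayedInflow z t i) - z t i, ?_, ?_, fun _ => ?_⟩
      · exact sub_pos.2 (lt_min hc this)
      · linarith [min_le_left (c t i) (lam t i + N.delayedInflow z t i)]
      · linarith [min_le_right (c t i) (lam t i + N.delayedInflow z t i)]
    · exact ⟨c t i - z t i, by linarith, by linarith, fun h => absurd h hx0⟩
  -- Raising one coordinate into its slack only relaxes the inflow constraints, as `R` is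
  -- nonnegative, and strictly improves the objective.
  set w : E → ℝ := Function.update (z t) i (z t i + d) with hw
  have hzw : ∀ j, z t j ≤ w j := by
    intro j
    by_cases hj : j = i
    · subst hj; simp [hw, hd.le]
    · simp [hw, hj]
  have hsum : ∀ k, ∑ j ∈ N.zeroDelay k, N.R j k * z t j ≤ ∑ j ∈ N.zeroDelay k, N.R j k * w j :=
    fun k => Finset.sum_le_sum fun j _ => mul_le_mul_of_nonneg_left (hzw j) (N.R_nonneg j k)
  have hfeas : w ∈ N.feasibleOutflows (x t) (N.netInflow lam z t) (c t) := by
    refine ⟨fun k => ?_, fun k hk => ?_⟩ <;> by_cases hki : k = i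
    · subst hki; simpa [hw] using hdc
    · simpa [hw, hki] using h.outflow_le_capacity ht k
    · subst hki
      have := hdx hk
      rw [← netInflow_add_zeroDelay] at this
      have hwk : w k = z t k + d := by simp [hw]
      linarith [hsum k]
    · have hwk : w k = z t k := by simp [hw, hki]
      linarith [hsum k, (h.outflow_mem t ht).2 k hk]
  refine absurd (h.outflow_optimal t ht w hfeas) (not_le.2 ?_)
  refine Finset.sum_lt_sum (fun j _ => mul_le_mul_of_nonneg_left (hzw j) (hη j).le)
    ⟨i, Finset.mem_univ i, mul_lt_mul_of_pos_left ?_ (hη i)⟩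
  simp [hw, hd]

theorem queue_eq (h : N.IsTrajectory η lam c x z) {t : ℝ} (ht : 0 ≤ t) (i : E) :
    x t i = x 0 i + ∫ s in (0 : ℝ)..t, (lam s i + N.delayedInflow z s i - z s i) := by
  simpa only [netInflow_add_zeroDelay] using h.queue_dynamics t ht i

/-- The difference of two trajectories contracts pointwise on each link. -/
theorem sign_mul_le (hη : ∀ i, 0 < η i) (h : N.IsTrajectory η lam c x z)
    (h' : N.IsTrajectory η lam c x' z') {t : ℝ} (ht : 0 ≤ t) (i : E) :
    (SignType.sign (x t i - x' t i) : ℝ) * (N.delayedInflow (z - z') t i - (z - z') t i)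
      ≤ |N.delayedInflow (z - z') t i| - |(z - z') t i| := by
  rw [delayedInflow_sub]
  simp only [Pi.sub_apply]
  have hx := h.queue_nonneg t ht i
  have hx' := h'.queue_nonneg t ht i
  have hz := h.outflow_le_capacity ht i
  have hz' := h'.outflow_le_capacity ht i
  have hi := h.outflow_le_inflow ht (i := i)
  have hi' := h'.outflow_le_inflow ht (i := i)
  have he := outflow_eq hη h ht i
  have he' := outflow_eq hη h' ht i
  generalize N.delayedInflow z t i = a at *
  generalize N.delayedInflow z' t i = a' at *
  -- The strictly longer queue is positive, so its outflow is at capacity and the outflow difference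
  -- has the sign of the queue difference.
  rcases lt_trichotomy (x t i) (x' t i) with hlt | heq | hgt
  · have h1 : z' t i = c t i := he'.resolve_right fun hh => by linarith [hh.1]
    rw [sign_neg (by linarith), abs_of_nonpos (a := z t i - z' t i) (by linarith)]
    simp only [SignType.coe_neg_one]
    linarith [neg_le_abs (a - a')]
  · rw [heq, sub_self, sign_zero]
    simp only [SignType.coe_zero, zero_mul, sub_nonneg]
    -- On two empty queues both outflows are the minimum of capacity and inflow, which is
    -- 1-Lipschitz in the inflow.
    by_cases h0 : x' t i = 0
    · have hi := hi (heq.trans h0)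
      have hi' := hi' h0
      have h1 := le_abs_self (a - a')
      have h2 := neg_le_abs (a - a')
      rw [abs_le]
      constructor
      · rcases he with he | he <;> linarith [he]
      · rcases he' with he' | he' <;> linarith [he']
    · have h1 : z' t i = c t i := he'.resolve_right fun hh => h0 hh.1
      have h2 : z t i = c t i := he.resolve_right fun hh => h0 (heq ▸ hh.1)
      rw [h1, h2, sub_self, abs_zero]
      exact abs_nonneg _
  · have h1 : z t i = c t i := he.resolve_right fun hh => by linarith [hh.1]
    rw [sign_pos (by linarith), abs_of_nonneg (a := z t i - z' t i) (by linarith)]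
    simp only [SignType.coe_one, one_mul]
    linarith [le_abs_self (a - a')]

theorem queue_sub_eq (hlam : ∀ i, ∀ b, 0 < b → PiecewiseConstantOn (fun t => lam t i) 0 b)
    (h : N.IsTrajectory η lam c x z) (h' : N.IsTrajectory η lam c x' z') {t : ℝ} (ht : 0 ≤ t)
    (i : E) : x t i - x' t i = x 0 i - x' 0 i
      + ∫ s in (0 : ℝ)..t, (N.delayedInflow (z - z') s i - (z - z') s i) := by
  have hl : IntervalIntegrable (fun s => lam s i) volume 0 t := by
    rcases ht.eq_or_lt with rfl | ht
    · exact IntervalIntegrable.refl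
    · exact (hlam i t ht).intervalIntegrable
  have H := h.departuresIntegrable
  have H' := h'.departuresIntegrable
  rw [h.queue_eq ht, h'.queue_eq ht, add_sub_add_comm, ← intervalIntegral.integral_sub
    ((hl.add (H.delayedInflow i le_rfl ht)).sub (H.of_nonneg i le_rfl ht))
    ((hl.add (H'.delayedInflow i le_rfl ht)).sub (H'.of_nonneg i le_rfl ht))]
  congr 1
  refine intervalIntegral.integral_congr fun s _ => ?_
  simp only [delayedInflow_sub, Pi.sub_apply]
  ring

/-- The balance inequality for the distance of two trajectories on a single link. -/
theorem abs_queue_sub_add_le (hη : ∀ i, 0 < η i)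
    (hlam : ∀ i, ∀ b, 0 < b → PiecewiseConstantOn (fun t => lam t i) 0 b)
    (h : N.IsTrajectory η lam c x z) (h' : N.IsTrajectory η lam c x' z') {t : ℝ} (ht : 0 ≤ t)
    (i : E) :
    |x t i - x' t i| + ∫ s in (0 : ℝ)..t, |(z - z') s i| ≤ |x 0 i - x' 0 i|
      + ∑ j, N.R j i * ((∫ s in (0 - N.δ j i : ℝ)..0, |(z - z') s j|)
          + (∫ s in (0 : ℝ)..t, |(z - z') s j|) - ∫ s in (t - N.δ j i)..t, |(z - z') s j|) := by
  have H := h.departuresIntegrable.sub h'.departuresIntegrable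
  have h1 := H.of_nonneg i le_rfl ht
  have h2 := H.abs.delayedInflow i le_rfl ht
  have key := abs_le_abs_add_integral_of_sign_mul_le (f := fun s => x s i - x' s i) ht
    ((H.delayedInflow i le_rfl ht).sub h1) (h2.sub h1.abs)
    (fun s hs => queue_sub_eq hlam h h' hs.1 i)
    (fun s hs => (sign_mul_le hη h h' hs.1 i).trans
      (sub_le_sub_right (abs_delayedInflow_le _ _ _) _))
  rw [intervalIntegral.integral_sub h2 h1.abs, H.abs.integral_delayedInflow i le_rfl ht] at key
  rw [Finset.sum_congr rfl fun j _ => H.abs.mul_integral_shift j i ht] at key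
  linarith

end IsTrajectory

/-- The distance of two trajectories does not increase. -/
theorem IsTrajectory.distance_le {η : E → ℝ} {lam c x z x' z' : ℝ → E → ℝ} (hη : ∀ i, 0 < η i)
    (hlam : ∀ i, ∀ b, 0 < b → PiecewiseConstantOn (fun t => lam t i) 0 b)
    (h : N.IsTrajectory η lam c x z) (h' : N.IsTrajectory η lam c x' z') {t : ℝ} (ht : 0 ≤ t) :
    ∑ i, |x t i - x' t i| + N.historyNorm (z - z') t
      ≤ ∑ i, |x 0 i - x' 0 i| + N.historyNorm (z - z') 0 := by
  have key := Finset.sum_le_sum fun i (_ : i ∈ Finset.univ) =>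
    abs_queue_sub_add_le hη hlam h h' ht i
  simp only [mul_sub, mul_add, Finset.sum_add_distrib, Finset.sum_sub_distrib] at key
  -- This absorbs the routed departures into the departure integrals on the left of the balance
  -- inequality.
  have hrow : ∑ i, ∑ j, N.R j i * ∫ s in (0 : ℝ)..t, |(z - z') s j|
      ≤ ∑ j, ∫ s in (0 : ℝ)..t, |(z - z') s j| := by
    rw [Finset.sum_comm]
    refine Finset.sum_le_sum fun j _ => ?_
    rw [← Finset.sum_mul]
    exact mul_le_of_le_one_left
      (intervalIntegral.integral_nonneg ht fun _ _ => abs_nonneg _) (N.R_rowSum_le_one j)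
  simp only [historyNorm]
  linarith

/-! ### Consequences of stability and periodicity. -/

/-- A maximum principle for the routing matrix: a vector `A` with `A ≤ K + Rᵀ A` is bounded by a
multiple of any nonnegative vector `v` with `v ≥ ε + Rᵀ v`. -/
theorem le_of_le_add_sum_mul {A v : E → ℝ} {K ε : ℝ} (hK : 0 ≤ K) (hε : 0 < ε)
    (hv0 : ∀ i, 0 ≤ v i) (hv : ∀ i, ∑ j, N.R j i * v j + ε ≤ v i)
    (hA : ∀ i, A i ≤ K + ∑ j, N.R j i * A j) (i : E) : A i ≤ K / ε * v i := by
  have hvpos : ∀ i, 0 < v i := fun i => by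
    have := Finset.sum_nonneg fun j (_ : j ∈ Finset.univ) => mul_nonneg (N.R_nonneg j i) (hv0 j)
    linarith [hv i]
  obtain ⟨k, -, hk⟩ := Finset.exists_max_image Finset.univ (fun i => A i / v i)
    ⟨i, Finset.mem_univ i⟩
  have hle : ∀ j, A j ≤ A k / v k * v j := fun j =>
    (div_le_iff₀ (hvpos j)).1 (hk j (Finset.mem_univ j))
  set θ := A k / v k
  have hAk : A k = θ * v k := (div_mul_cancel₀ _ (hvpos k).ne').symm
  refine (hle i).trans (mul_le_mul_of_nonneg_right ?_ (hv0 i))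
  rw [le_div_iff₀ hε]
  have h1 : ∑ j, N.R j k * A j ≤ θ * ∑ j, N.R j k * v j := by
    rw [Finset.mul_sum]
    refine Finset.sum_le_sum fun j _ => ?_
    have := mul_le_mul_of_nonneg_left (hle j) (N.R_nonneg j k)
    linarith
  -- At the maximizer `k` of A/v, for θ ≥ 0: θ v_k ≤ K + θ (v_k - ε), that is, θ ε ≤ K.
  rcases le_total θ 0 with hθ0 | hθ0
  · exact (mul_nonpos_of_nonpos_of_nonneg hθ0 hε.le).trans hK
  · nlinarith [hA k, mul_le_mul_of_nonneg_left (hv k) hθ0]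

theorem stability_apply {T ε : ℝ} {lam c : ℝ → E → ℝ} {i : E} [DecidableEq E]
    (h : ((1 - N.Rᵀ) *ᵥ periodAverage T c) i > periodAverage T lam i + ε) :
    periodAverage T lam i + ∑ j, N.R j i * periodAverage T c j + ε < periodAverage T c i := by
  rw [Matrix.sub_mulVec, Matrix.one_mulVec, Pi.sub_apply] at h
  have : (N.Rᵀ *ᵥ periodAverage T c) i = ∑ j, N.R j i * periodAverage T c j := rfl
  linarith

theorem periodAverage_nonneg {T : ℝ} (hT : 0 < T) {ι : Type*} {f : ℝ → ι → ℝ}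
    (hf : ∀ t, 0 ≤ t → ∀ i, 0 ≤ f t i) (i : ι) : 0 ≤ periodAverage T f i :=
  mul_nonneg (by positivity) (intervalIntegral.integral_nonneg hT.le fun t ht => hf t ht.1 i)

theorem intervalIntegrable_of_piecewiseConstantOn {f : ℝ → ℝ}
    (hf : ∀ b, 0 < b → PiecewiseConstantOn f 0 b) {a b : ℝ} (ha : 0 ≤ a) (hb : 0 ≤ b) :
    IntervalIntegrable f volume a b := by
  have key : ∀ a, 0 ≤ a → IntervalIntegrable f volume 0 a := fun a ha => by
    rcases ha.eq_or_lt with rfl | ha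
    · exact IntervalIntegrable.refl
    · exact (hf a ha).intervalIntegrable
  exact (key a ha).symm.trans (key b hb)

/-- The integral over a period does not depend on its starting point. -/
theorem integral_period_eq {T : ℝ} (hT : 0 < T) {ι : Type*} {f : ℝ → ι → ℝ} {i : ι}
    (hf : ∀ b, 0 < b → PiecewiseConstantOn (fun t => f t i) 0 b)
    (hper : ∀ t, 0 ≤ t → f (t + T) = f t) {a : ℝ} (ha : 0 ≤ a) :
    ∫ s in a..(a + T), f s i = T * periodAverage T f i := by
  have I : ∀ {a b : ℝ}, 0 ≤ a → 0 ≤ b → IntervalIntegrable (fun s => f s i) volume a b :=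
    intervalIntegrable_of_piecewiseConstantOn hf
  have e1 := intervalIntegral.integral_add_adjacent_intervals
    (I le_rfl ha) (I ha (by linarith : 0 ≤ a + T))
  have e2 := intervalIntegral.integral_add_adjacent_intervals
    (I le_rfl hT.le) (I hT.le (by linarith : 0 ≤ a + T))
  have e3 : ∫ s in T..(a + T), f s i = ∫ s in (0 : ℝ)..a, f s i := by
    have := intervalIntegral.integral_comp_add_right (fun s => f s i) (a := 0) (b := a) T
    rw [zero_add] at this
    rw [← this]
    refine intervalIntegral.integral_congr fun s hs => ?_
    rw [uIcc_of_le ha] at hs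
    simp only [hper s hs.1]
  rw [periodAverage, ← mul_assoc, mul_one_div_cancel hT.ne', one_mul]
  linarith

/-! ### Convergence of queues and histories. -/

namespace IsTrajectory

variable {η : E → ℝ} {lam c x z x' z' : ℝ → E → ℝ}

/-- Dropping the current queue and transit differences from the balance inequality leaves the
hypothesis of `le_of_le_add_sum_mul`, with `K` the total initial distance; the resulting bound is
uniform in time. -/
theorem outflow_sub_integrableOn (hη : ∀ i, 0 < η i)
    (hlam : ∀ i, ∀ b, 0 < b → PiecewiseConstantOn (fun t => lam t i) 0 b)
    (h : N.IsTrajectory η lam c x z) (h' : N.IsTrajectory η lam c x' z') {v : E → ℝ} {ε : ℝ}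
    (hε : 0 < ε) (hv0 : ∀ i, 0 ≤ v i) (hv : ∀ i, ∑ j, N.R j i * v j + ε ≤ v i) (i : E) :
    IntegrableOn (fun s => (z - z') s i) (Ioi 0) := by
  have H := h.departuresIntegrable.sub h'.departuresIntegrable
  have hQ : ∀ i, 0 ≤ ∑ j, N.R j i * ∫ s in (0 - N.δ j i : ℝ)..0, |(z - z') s j| := fun i =>
    Finset.sum_nonneg fun j _ => mul_nonneg (N.R_nonneg j i) <|
      intervalIntegral.integral_nonneg (by simp) fun _ _ => abs_nonneg _
  set K : ℝ := ∑ i, (|x 0 i - x' 0 i|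
    + ∑ j, N.R j i * ∫ s in (0 - N.δ j i : ℝ)..0, |(z - z') s j|)
  have hterm : ∀ i, 0 ≤ |x 0 i - x' 0 i|
      + ∑ j, N.R j i * ∫ s in (0 - N.δ j i : ℝ)..0, |(z - z') s j| :=
    fun i => add_nonneg (abs_nonneg _) (hQ i)
  have hK0 : 0 ≤ K := Finset.sum_nonneg fun i _ => hterm i
  have bound : ∀ t : ℝ, 0 ≤ t → ∫ s in (0 : ℝ)..t, |(z - z') s i| ≤ K / ε * v i := by
    intro t ht
    refine N.le_of_le_add_sum_mul (A := fun i => ∫ s in (0 : ℝ)..t, |(z - z') s i|)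
      hK0 hε hv0 hv (fun k => ?_) i
    have h1 := abs_queue_sub_add_le hη hlam h h' ht k
    have h2 := Finset.single_le_sum (fun i _ => hterm i) (Finset.mem_univ k)
    have h3 : 0 ≤ ∑ j, N.R j k * ∫ s in (t - N.δ j k)..t, |(z - z') s j| :=
      Finset.sum_nonneg fun j _ => mul_nonneg (N.R_nonneg j k) <|
        intervalIntegral.integral_nonneg (by simp) fun _ _ => abs_nonneg _
    simp only [mul_sub, mul_add, Finset.sum_add_distrib, Finset.sum_sub_distrib] at h1
    linarith [abs_nonneg (x t k - x' t k)]
  refine integrableOn_Ioi_of_intervalIntegral_norm_bounded (b := fun n : ℕ => (n : ℝ))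
    (l := atTop) (K / ε * v i) 0 (fun n => ?_) tendsto_natCast_atTop_atTop
    (Eventually.of_forall fun n => bound n n.cast_nonneg)
  rw [← intervalIntegrable_iff_integrableOn_Ioc_of_le n.cast_nonneg]
  exact H.of_nonneg i le_rfl n.cast_nonneg

/-- If both queues on a link empty at arbitrarily late times and the total outflow difference is
finite, the queues converge to each other. -/
theorem tendsto_queue_sub (hlam : ∀ i, ∀ b, 0 < b → PiecewiseConstantOn (fun t => lam t i) 0 b)
    (h : N.IsTrajectory η lam c x z) (h' : N.IsTrajectory η lam c x' z')
    (hint : ∀ i, IntegrableOn (fun s => (z - z') s i) (Ioi 0)) {i : E}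
    (hx : ∃ᶠ t in atTop, x t i = 0) (hx' : ∃ᶠ t in atTop, x' t i = 0) :
    Tendsto (fun t => x t i - x' t i) atTop (𝓝 0) := by
  have H := h.departuresIntegrable.sub h'.departuresIntegrable
  -- Before time `δ j i` arrivals come from the departure history; afterwards they are a shift of
  -- departures on the positive axis.
  have hterm : ∀ j, IntegrableOn (fun s => N.R j i * (z - z') (s - N.δ j i) j) (Ioi 0) := by
    intro j
    have hδ := (N.δ j i).coe_nonneg
    have h1 : IntegrableOn (fun s => N.R j i * (z - z') (s - N.δ j i) j) (Ioc 0 (N.δ j i)) :=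
      (intervalIntegrable_iff_integrableOn_Ioc_of_le hδ).1 (H.term j i le_rfl hδ)
    have h2 : IntegrableOn (fun s => N.R j i * (z - z') (s - N.δ j i) j) (Ioi (N.δ j i)) := by
      refine Integrable.const_mul ?_ _
      have := (measurePreserving_sub_right volume (N.δ j i : ℝ)).integrableOn_comp_preimage
        (MeasurableEquiv.subRight (N.δ j i : ℝ)).measurableEmbedding
        (f := fun s => (z - z') s j) (s := Ioi 0)
      rw [show (fun s : ℝ => s - N.δ j i) ⁻¹' Ioi 0 = Ioi (N.δ j i : ℝ) by ext; simp] at this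
      exact this.2 (hint j)
    rw [← Ioc_union_Ioi_eq_Ioi hδ]
    exact h1.union h2
  have hG : IntegrableOn (fun s => N.delayedInflow (z - z') s i - (z - z') s i) (Ioi 0) :=
    (integrable_finsetSum Finset.univ fun j _ => hterm j).sub (hint i)
  obtain ⟨l, hl⟩ : ∃ l, Tendsto (fun t => x t i - x' t i) atTop (𝓝 l) :=
    ⟨_, ((intervalIntegral_tendsto_integral_Ioi 0 hG tendsto_id).const_add _).congr' <| by
      filter_upwards [eventually_ge_atTop 0] with t ht using (queue_sub_eq hlam h h' ht i).symm⟩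
  have h1 : l ≤ 0 := by
    refine le_of_tendsto_of_frequently hl ((hx.and_eventually (eventually_ge_atTop 0)).mono ?_)
    rintro t ⟨h0, ht⟩
    linarith [h'.queue_nonneg t ht i]
  have h2 : 0 ≤ l := by
    refine ge_of_tendsto_of_frequently hl ((hx'.and_eventually (eventually_ge_atTop 0)).mono ?_)
    rintro t ⟨h0, ht⟩
    linarith [h.queue_nonneg t ht i]
  rwa [le_antisymm h1 h2] at hl

/-- Under the stability condition each queue is empty at arbitrarily late times. -/
theorem frequently_queue_eq_zero (hη : ∀ i, 0 < η i)
    (hlam : ∀ i, ∀ b, 0 < b → PiecewiseConstantOn (fun t => lam t i) 0 b)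
    (hc : ∀ i, ∀ b, 0 < b → PiecewiseConstantOn (fun t => c t i) 0 b)
    (h : N.IsTrajectory η lam c x z) {T ε : ℝ} (hT : 0 < T) (hε : 0 < ε)
    (hlamT : ∀ t, 0 ≤ t → lam (t + T) = lam t) (hcT : ∀ t, 0 ≤ t → c (t + T) = c t) {i : E}
    (hst : periodAverage T lam i + ∑ j, N.R j i * periodAverage T c j + ε
      < periodAverage T c i) : ∃ᶠ t in atTop, x t i = 0 := by
  intro hne
  obtain ⟨b, hb⟩ := eventually_atTop.1 hne
  -- After time `D` all arrivals at `i` departed at nonnegative times, where outflows are bounded by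
  -- capacity. A queue that never empties again would then lose at least T ε per period.
  set D : ℝ := ∑ j, (N.δ j i : ℝ)
  have hDj : ∀ j, (N.δ j i : ℝ) ≤ D := fun j =>
    Finset.single_le_sum (f := fun j => (N.δ j i : ℝ)) (fun j _ => (N.δ j i).coe_nonneg)
      (Finset.mem_univ j)
  set s₀ := max b D
  have H := h.departuresIntegrable
  have step : ∀ s, s₀ ≤ s → x (s + T) i ≤ x s i - T * ε := by
    intro s hs
    have hbs : b ≤ s := (le_max_left _ _).trans hs
    have hDs : ∀ j, (N.δ j i : ℝ) ≤ s := fun j => (hDj j).trans ((le_max_right _ _).trans hs)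
    have hs0 : 0 ≤ s := (Finset.sum_nonneg fun j _ => (N.δ j i).coe_nonneg).trans
      ((le_max_right _ _).trans hs)
    have hsT : 0 ≤ s + T := by linarith
    have hl : ∀ {a b : ℝ}, 0 ≤ a → 0 ≤ b → IntervalIntegrable (fun s => lam s i) volume a b :=
      intervalIntegrable_of_piecewiseConstantOn (hlam i)
    have hcI : ∀ j, ∀ {a b : ℝ}, 0 ≤ a → 0 ≤ b →
        IntervalIntegrable (fun s => c s j) volume a b :=
      fun j => intervalIntegrable_of_piecewiseConstantOn (hc j)
    have G : ∀ {a b : ℝ}, 0 ≤ a → 0 ≤ b →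
        IntervalIntegrable (fun s => lam s i + N.delayedInflow z s i - z s i) volume a b :=
      fun ha hb => ((hl ha hb).add (H.delayedInflow i ha hb)).sub (H.of_nonneg i ha hb)
    have hx : x (s + T) i - x s i
        = ∫ r in s..(s + T), (lam r i + N.delayedInflow z r i - z r i) := by
      rw [h.queue_eq hsT, h.queue_eq hs0,
        ← intervalIntegral.integral_add_adjacent_intervals (G le_rfl hs0) (G hs0 hsT)]
      ring
    have hz : ∫ r in s..(s + T), z r i = T * periodAverage T c i := by
      rw [← integral_period_eq hT (hc i) hcT hs0]
      refine intervalIntegral.integral_congr fun r hr => ?_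
      rw [uIcc_of_le (by linarith)] at hr
      exact (outflow_eq hη h (hs0.trans hr.1) i).resolve_right
        fun hh => hb r (hbs.trans hr.1) hh.1
    have hin : ∫ r in s..(s + T), N.delayedInflow z r i
        ≤ T * ∑ j, N.R j i * periodAverage T c j := by
      rw [H.integral_delayedInflow i hs0 hsT, Finset.mul_sum]
      refine Finset.sum_le_sum fun j _ => ?_
      have hsj : 0 ≤ s - N.δ j i := by linarith [hDs j]
      have hle : ∫ r in (s - N.δ j i)..(s + T - N.δ j i), z r j ≤ T * periodAverage T c j := by
        rw [← integral_period_eq hT (hc j) hcT hsj, sub_add_eq_add_sub]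
        exact intervalIntegral.integral_mono_on (by linarith)
          (H.of_nonneg j hsj (by linarith)) (hcI j hsj (by linarith))
          fun r hr => h.outflow_le_capacity (hsj.trans hr.1) j
      have := mul_le_mul_of_nonneg_left hle (N.R_nonneg j i)
      linarith
    rw [intervalIntegral.integral_sub ((hl hs0 hsT).add (H.delayedInflow i hs0 hsT))
      (H.of_nonneg i hs0 hsT), intervalIntegral.integral_add (hl hs0 hsT)
      (H.delayedInflow i hs0 hsT), integral_period_eq hT (hlam i) hlamT hs0, hz] at hx
    have := mul_lt_mul_of_pos_left hst hT
    linarith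
  have iter : ∀ n : ℕ, x (s₀ + n * T) i ≤ x s₀ i - n * (T * ε) := by
    intro n
    induction n with
    | zero => simp
    | succ n ih =>
      have := step (s₀ + n * T) (by linarith [mul_nonneg n.cast_nonneg hT.le])
      push_cast
      rw [show s₀ + (n + 1) * T = s₀ + n * T + T by ring]
      linarith
  obtain ⟨n, hn⟩ := exists_nat_gt (x s₀ i / (T * ε))
  rw [div_lt_iff₀ (mul_pos hT hε)] at hn
  have hs₀0 : 0 ≤ s₀ := (Finset.sum_nonneg fun j _ => (N.δ j i).coe_nonneg).trans
    (le_max_right _ _)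
  linarith [iter n, h.queue_nonneg (s₀ + n * T) (by positivity) i]

end IsTrajectory

/-- Each window integral is the difference of two values of one convergent improper integral. -/
theorem tendsto_historyNorm {z : ℝ → E → ℝ} (hint : ∀ i, IntegrableOn (fun s => z s i) (Ioi 0)) :
    Tendsto (fun t => N.historyNorm z t) atTop (𝓝 0) := by
  have key : ∀ i j, Tendsto (fun t => N.R j i * ∫ s in (t - N.δ j i)..t, |z s j|) atTop (𝓝 0) := by
    intro i j
    have hj : IntegrableOn (fun s => |z s j|) (Ioi 0) := (hint j).abs
    have hI : ∀ {a : ℝ}, 0 ≤ a → IntervalIntegrable (fun s => |z s j|) volume 0 a := fun ha =>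
      (intervalIntegrable_iff_integrableOn_Ioc_of_le ha).2 (hj.mono_set Ioc_subset_Ioi_self)
    have h1 := intervalIntegral_tendsto_integral_Ioi 0 hj tendsto_id
    have h2 := intervalIntegral_tendsto_integral_Ioi 0 hj
      (tendsto_atTop_add_const_right atTop (-(N.δ j i : ℝ)) tendsto_id)
    have h3 := (h1.sub h2).const_mul (N.R j i)
    rw [sub_self, mul_zero] at h3
    refine h3.congr' ?_
    filter_upwards [eventually_ge_atTop (N.δ j i : ℝ)] with t ht
    have hδ := (N.δ j i).coe_nonneg
    simp only [id, ← sub_eq_add_neg]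
    rw [intervalIntegral.integral_interval_sub_left (hI (hδ.trans ht)) (hI (by linarith))]
  have := tendsto_finsetSum Finset.univ fun i _ => tendsto_finsetSum Finset.univ fun j _ => key i j
  simpa [historyNorm] using this

end

end TrafficNetwork

theorem mainTheorem8 {E : Type*} [Fintype E] (N : TrafficNetwork E)
    (η : E → ℝ) (hη : ∀ i, 0 < η i) (lam c : ℝ → E → ℝ)
    (hlam_nonneg : ∀ t, 0 ≤ t → ∀ i, 0 ≤ lam t i)
    (hc_nonneg : ∀ t, 0 ≤ t → ∀ i, 0 ≤ c t i)
    (hlam : ∀ i, ∀ b, 0 < b → PiecewiseConstantOn (fun t => lam t i) 0 b)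
    (hc : ∀ i, ∀ b, 0 < b → PiecewiseConstantOn (fun t => c t i) 0 b)
    (x z x' z' : ℝ → E → ℝ)
    (h : N.IsTrajectory η lam c x z) (h' : N.IsTrajectory η lam c x' z') :
    (∀ t, 0 ≤ t →
      ∑ i, |x t i - x' t i| + N.historyNorm (z - z') t
        ≤ ∑ i, |x 0 i - x' 0 i| + N.historyNorm (z - z') 0) ∧
    (∀ T, 0 < T →
      (∀ t, 0 ≤ t → lam (t + T) = lam t) →
      (∀ t, 0 ≤ t → c (t + T) = c t) →
      N.StabilityCondition T lam c →
        Filter.Tendsto (fun t => ∑ i, |x t i - x' t i|) Filter.atTop (nhds 0) ∧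
        Filter.Tendsto (fun t => N.historyNorm (z - z') t) Filter.atTop (nhds 0)) := by
  refine ⟨fun t ht => h.distance_le hη hlam h' ht, fun T hT hlamT hcT hst => ?_⟩
  classical
  obtain ⟨ε, hε, hst⟩ := hst
  have hst : ∀ i, TrafficNetwork.periodAverage T lam i
      + ∑ j, N.R j i * TrafficNetwork.periodAverage T c j + ε < TrafficNetwork.periodAverage T c i := fun i => by
    refine TrafficNetwork.stability_apply (N := N) ?_
    convert hst i
  -- The average capacity serves as `v`: the required inequality is stability with the nonnegative
  -- average inflow discarded.
  have hint := h.outflow_sub_integrableOn hη hlam h' hε (v := TrafficNetwork.periodAverage T c)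
    (TrafficNetwork.periodAverage_nonneg hT hc_nonneg)
    fun i => by linarith [hst i, TrafficNetwork.periodAverage_nonneg hT hlam_nonneg i]
  refine ⟨?_, TrafficNetwork.tendsto_historyNorm hint⟩
  have key := fun i => (h.tendsto_queue_sub hlam h' hint
    (h.frequently_queue_eq_zero hη hlam hc hT hε hlamT hcT (hst i))
    (h'.frequently_queue_eq_zero hη hlam hc hT hε hlamT hcT (hst i))).abs
  simpa using tendsto_finsetSum Finset.univ fun i _ => key i
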